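/- Let $\mathcal H,\mathcal K$ be finite-dimensional complex Hilbert spaces and let $\mathcal M\subseteq\mathcal B(\mathcal H)$, $\mathcal N\subseteq\mathcal B(\mathcal K)$ be matrix algebras, i.e. unital subalgebras closed under taking adjoints. Let $\mathcal T:\mathcal M\to\mathcal N$ be a completely positive trace-preserving linear map, and let $\sigma,\rho\in\mathcal M$ be positive definite quantum states ($\sigma,\rho>0$, $\operatorname{tr}\sigma=\operatorname{tr}\rho=1$) such that $\sigma_{\mathcal T}:=\mathcal T(\sigma)>0$ and $\rho_{\mathcal T}:=\mathcal T(\rho)>0$. Write $$\hat S_{\mathrm{BS}}(\sigma\|\rho):=-\operatorname{tr}\bigl[\sigma\log(\sigma^{-1/2}\rho\,\sigma^{-1/2})\bigr]$$ for the Belavkin–Staszewski relative entropy, and let $\mathcal T^*:\mathcal N\to\mathcal M$ be the adjoint of $\mathcal T$ with respect to the Hilbert–Schmidt inner products $\langle A,B\rangle=\operatorname{tr}[A^*B]$. Then $$\hat S_{\mathrm{BS}}(\sigma\|\rho)=\hat S_{\mathrm{BS}}(\sigma_{\mathcal T}\|\rho_{\mathcal T})\quad\Longleftrightarrow\quad \mathcal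 T^*\bigl(\sigma_{\mathcal T}^{-1}\rho_{\mathcal T}\bigr)=\sigma^{-1}\rho .$$ -/

import Mathlib

open scoped ComplexOrder

namespace BSEntropy

section Operators

variable {H : Type*} [NormedAddCommGroup H] [InnerProductSpace ℂ H]

/-- The trace of an operator on a finite-dimensional Hilbert space. -/
noncomputable def tr : (H →L[ℂ] H) →ₗ[ℂ] ℂ :=
  LinearMap.trace ℂ H ∘ₗ ContinuousLinearMap.coeLM ℂ

theorem tr_mul_comm (A B : H →L[ℂ] H) : tr (A * B) = tr (B * A) :=
  LinearMap.trace_mul_comm ℂ (A : H →ₗ[ℂ] H) (B : H →ₗ[ℂ] H)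

variable [FiniteDimensional ℂ H] [CompleteSpace H]

theorem tr_star (A : H →L[ℂ] H) : tr (star A) = star (tr A) := by
  simp only [tr, LinearMap.comp_apply, ContinuousLinearMap.coeLM_apply]
  rw [LinearMap.trace_eq_sum_inner _ (stdOrthonormalBasis ℂ H),
    LinearMap.trace_eq_sum_inner _ (stdOrthonormalBasis ℂ H), star_sum]
  refine Finset.sum_congr rfl fun i _ => ?_
  simp [ContinuousLinearMap.star_eq_adjoint, ContinuousLinearMap.adjoint_inner_right]

/-- The Hilbert-Schmidt inner product `⟨A, B⟩ = tr[A* B]`. -/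
noncomputable def hsInner (A B : H →L[ℂ] H) : ℂ := tr (star A * B)

theorem hsInner_conj_symm (A B : H →L[ℂ] H) : star (hsInner A B) = hsInner B A := by
  rw [hsInner, ← tr_star, star_mul, star_star, hsInner]

theorem hsInner_self_eq_zero {A : H →L[ℂ] H} (h : hsInner A A = 0) : A = 0 := by
  have h1 : hsInner A A = ((∑ i, ‖A (stdOrthonormalBasis ℂ H i)‖ ^ 2 : ℝ) : ℂ) := by
    simp only [hsInner, tr, LinearMap.comp_apply, ContinuousLinearMap.coeLM_apply]
    rw [LinearMap.trace_eq_sum_inner _ (stdOrthonormalBasis ℂ H)]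
    push_cast
    refine Finset.sum_congr rfl fun i _ => ?_
    simp [ContinuousLinearMap.star_eq_adjoint, ContinuousLinearMap.adjoint_inner_right,
      inner_self_eq_norm_sq_to_K]
  rw [h1, Complex.ofReal_eq_zero, Finset.sum_eq_zero_iff_of_nonneg fun i _ => sq_nonneg _] at h
  ext x
  have h2 : (A : H →ₗ[ℂ] H) = 0 :=
    (stdOrthonormalBasis ℂ H).toBasis.ext fun i => by
      have := h i (Finset.mem_univ i)
      simpa using this
  exact congrArg (fun f : H →ₗ[ℂ] H => f x) h2

/-- The Belavkin-Staszewski entropy `-tr[σ log(σ^{-1/2} ρ σ^{-1/2})]` of two positive definite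
operators. The powers and the logarithm are those of the continuous functional calculus; the trace
is a real number, see `bsEntropy_eq`. -/
noncomputable def bsEntropy (σ ρ : H →L[ℂ] H) : ℝ :=
  -(tr (σ * CFC.log (σ ^ (-(1 / 2) : ℝ) * ρ * σ ^ (-(1 / 2) : ℝ)))).re

theorem bsEntropy_eq {σ : H →L[ℂ] H} (hσ : IsSelfAdjoint σ) (ρ : H →L[ℂ] H) :
    (bsEntropy σ ρ : ℂ) =
      -tr (σ * CFC.log (σ ^ (-(1 / 2) : ℝ) * ρ * σ ^ (-(1 / 2) : ℝ))) := by
  set L : H →L[ℂ] H := CFC.log (σ ^ (-(1 / 2) : ℝ) * ρ * σ ^ (-(1 / 2) : ℝ)) with hL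
  have hLs : star L = L := IsSelfAdjoint.log
  have h : star (tr (σ * L)) = tr (σ * L) := by
    rw [← tr_star, star_mul, hLs, hσ.star_eq, tr_mul_comm]
  have h2 : ((tr (σ * L)).re : ℂ) = tr (σ * L) := Complex.conj_eq_iff_re.mp h
  rw [bsEntropy, ← hL, Complex.ofReal_neg, h2]

/-- Quantum states (density operators) of full rank: `σ > 0` and `tr[σ] = 1`. -/
def IsPosDefState (σ : H →L[ℂ] H) : Prop :=
  IsStrictlyPositive σ ∧ tr σ = 1

end Operators

/-! A matrix algebra on a finite-dimensional Hilbert space `H` is a unital subalgebra of the bounded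
operators on `H` closed under adjoints, that is, a term of `StarSubalgebra ℂ (H →L[ℂ] H)`. -/

section MatrixAlgebras

variable {H : Type*} [NormedAddCommGroup H] [InnerProductSpace ℂ H] [CompleteSpace H]
variable {K : Type*} [NormedAddCommGroup K] [InnerProductSpace ℂ K] [CompleteSpace K]

/-- An element `A` of `M ⊗ Mₖ`, written as a `k × k` matrix with entries in `M`, is positive
semidefinite as an operator on `H ⊗ ℂᵏ = Hᵏ`. -/
def BlockPosSemidef {M : StarSubalgebra ℂ (H →L[ℂ] H)} {k : ℕ}
    (A : Matrix (Fin k) (Fin k) M) : Prop :=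
  ∀ v : Fin k → H, 0 ≤ ∑ i, ∑ j, inner ℂ (v i) ((A i j : H →L[ℂ] H) (v j))

/-- `T` is completely positive: every `T ⊗ Idₖ` maps positive semidefinite elements of `M ⊗ Mₖ` to
positive semidefinite elements of `N ⊗ Mₖ`. -/
def IsCompletelyPositive {M : StarSubalgebra ℂ (H →L[ℂ] H)} {N : StarSubalgebra ℂ (K →L[ℂ] K)}
    (T : M →ₗ[ℂ] N) : Prop :=
  ∀ (k : ℕ) (A : Matrix (Fin k) (Fin k) M), BlockPosSemidef A → BlockPosSemidef (A.map T)

/-- `T` preserves the trace. -/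
def IsTracePreserving {M : StarSubalgebra ℂ (H →L[ℂ] H)} {N : StarSubalgebra ℂ (K →L[ℂ] K)}
    (T : M →ₗ[ℂ] N) : Prop :=
  ∀ A : M, tr (T A : K →L[ℂ] K) = tr (A : H →L[ℂ] H)

variable [FiniteDimensional ℂ H] [FiniteDimensional ℂ K]

theorem hsInner_ext {M : StarSubalgebra ℂ (H →L[ℂ] H)} {A B : M}
    (h : ∀ X : M, hsInner (X : H →L[ℂ] H) A = hsInner (X : H →L[ℂ] H) B) : A = B := by
  have h1 : hsInner ((A - B : M) : H →L[ℂ] H) (A - B : M) = 0 := by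
    have := h (A - B)
    rw [hsInner, hsInner, ← sub_eq_zero, ← map_sub, ← mul_sub] at this
    exact this
  have h2 := hsInner_self_eq_zero h1
  exact sub_eq_zero.mp (Subtype.ext h2)

/-- Every linear functional on `M` is `Z ↦ ⟨X, Z⟩` for some `X` in `M`. -/
theorem exists_hsInner_eq {M : StarSubalgebra ℂ (H →L[ℂ] H)} (f : Module.Dual ℂ M) :
    ∃ X : M, ∀ Z : M, hsInner (X : H →L[ℂ] H) Z = f Z := by
  have : FiniteDimensional ℂ M :=
    FiniteDimensional.finiteDimensional_submodule M.toSubalgebra.toSubmodule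
  let R : M →ₗ[ℂ] Module.Dual ℂ M :=
    LinearMap.mk₂ ℂ (fun X Z : M => tr ((X : H →L[ℂ] H) * (Z : H →L[ℂ] H)))
      (fun a b c => by simp [add_mul]) (fun a b c => by simp)
      (fun a b c => by simp [mul_add]) (fun a b c => by simp)
  have hinj : Function.Injective R := by
    rw [injective_iff_map_eq_zero]
    intro X hX
    have h1 : tr ((X : H →L[ℂ] H) * star (X : H →L[ℂ] H)) = 0 :=
      congrArg (fun g : Module.Dual ℂ M => g (star X)) hX
    have h2 : star (X : H →L[ℂ] H) = 0 :=
      hsInner_self_eq_zero (by rw [hsInner, star_star, h1])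
    exact Subtype.ext (star_eq_zero.mp h2)
  have hsurj : Function.Surjective R :=
    (LinearMap.injective_iff_surjective_of_finrank_eq_finrank
      Subspace.dual_finrank_eq.symm).mp hinj
  obtain ⟨X, hX⟩ := hsurj f
  refine ⟨star X, fun Z => ?_⟩
  rw [← hX]
  simp [hsInner, R]

theorem existsUnique_hsAdjoint {M : StarSubalgebra ℂ (H →L[ℂ] H)}
    {N : StarSubalgebra ℂ (K →L[ℂ] K)} (T : M →ₗ[ℂ] N) :
    ∃! S : N →ₗ[ℂ] M, ∀ (X : M) (Y : N),
      hsInner (T X : K →L[ℂ] K) Y = hsInner (X : H →L[ℂ] H) (S Y) := by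
  have key : ∀ Y : N, ∃ Z : M, ∀ X : M,
      hsInner (T X : K →L[ℂ] K) Y = hsInner (X : H →L[ℂ] H) Z := by
    intro Y
    obtain ⟨Z, hZ⟩ := exists_hsInner_eq (M := M)
      { toFun := fun X => hsInner (Y : K →L[ℂ] K) (T X)
        map_add' := fun a b => by simp [hsInner, mul_add]
        map_smul' := fun c a => by simp [hsInner] }
    refine ⟨Z, fun X => ?_⟩
    rw [← hsInner_conj_symm, ← hsInner_conj_symm (Z : H →L[ℂ] H), hZ X]
    rfl
  choose S hS using key
  refine ⟨{ toFun := S, map_add' := fun a b => ?_, map_smul' := fun c a => ?_ },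
    fun X Y => hS Y X, fun S' hS' => ?_⟩
  · refine hsInner_ext fun X => ?_
    rw [← hS]
    have ha := hS a X
    have hb := hS b X
    simp only [hsInner] at ha hb ⊢
    simp [mul_add, ha, hb]
  · refine hsInner_ext fun X => ?_
    rw [← hS]
    have ha := hS a X
    simp only [hsInner] at ha ⊢
    simp [ha]
  · refine LinearMap.ext fun Y => hsInner_ext fun X => ?_
    rw [← hS' X Y]
    exact hS Y X

/-- The adjoint `T* : N → M` of `T : M → N` with respect to the Hilbert-Schmidt inner products. -/
noncomputable def hsAdjoint {M : StarSubalgebra ℂ (H →L[ℂ] H)} {N : StarSubalgebra ℂ (K →L[ℂ] K)}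
    (T : M →ₗ[ℂ] N) : N →ₗ[ℂ] M :=
  (existsUnique_hsAdjoint T).choose

theorem hsInner_hsAdjoint {M : StarSubalgebra ℂ (H →L[ℂ] H)} {N : StarSubalgebra ℂ (K →L[ℂ] K)}
    (T : M →ₗ[ℂ] N) (X : M) (Y : N) :
    hsInner (T X : K →L[ℂ] K) Y = hsInner (X : H →L[ℂ] H) (hsAdjoint T Y) :=
  (existsUnique_hsAdjoint T).choose_spec.1 X Y

/-- An element of a matrix algebra that is invertible as an operator is invertible in the algebra;
so `Ring.inverse`, taken in `M`, is then the inverse of the operator. -/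
theorem coe_ringInverse {M : StarSubalgebra ℂ (H →L[ℂ] H)} {A : M}
    (hA : IsUnit (A : H →L[ℂ] H)) :
    (A : H →L[ℂ] H) * (Ring.inverse A : M) = 1 ∧ ((Ring.inverse A : M) : H →L[ℂ] H) * A = 1 := by
  have : FiniteDimensional ℂ M :=
    FiniteDimensional.finiteDimensional_submodule M.toSubalgebra.toSubmodule
  have hinj : Function.Injective (LinearMap.mulLeft ℂ A) := fun X Y h => by
    have h1 : (A : H →L[ℂ] H) * X = A * Y := congrArg Subtype.val h
    exact Subtype.ext (hA.mul_left_cancel h1)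
  obtain ⟨B, hB⟩ := (LinearMap.injective_iff_surjective.mp hinj) 1
  have hAB : (A : H →L[ℂ] H) * B = 1 := congrArg Subtype.val hB
  have hBA : B * A = 1 := by
    refine Subtype.ext (hA.mul_left_cancel ?_)
    change (A : H →L[ℂ] H) * (B * A) = A * 1
    rw [← mul_assoc, hAB, one_mul, mul_one]
  have hu : IsUnit A := ⟨⟨A, B, hB, hBA⟩, rfl⟩
  exact ⟨congrArg Subtype.val (Ring.mul_inverse_cancel A hu),
    congrArg Subtype.val (Ring.inverse_mul_cancel A hu)⟩

end MatrixAlgebras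

end BSEntropy

namespace BSEntropy

/-! ### Positivity and faithfulness of the trace. -/

section Operators

variable {H : Type*} [NormedAddCommGroup H] [InnerProductSpace ℂ H]

/-! Put Γ = σ^{-1/2} ρ σ^{-1/2}, and let Γ' be its analogue for T σ, T ρ. As spectra are finite, f ↦
tr[σ f(Γ)] - tr[T(σ) f(Γ')] is a finite signed measure c on (0, ∞)
(`exists_re_tr_cfc_relOp_sub_eq_sum`), and equality of entropies says exactly that c integrates log
to 0. Its moments of order 0 and 1 vanish because T preserves the trace; its second moment is the
defect tr[ρ σ⁻¹ ρ] - tr[T(ρ) T(σ)⁻¹ T(ρ)].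

Entropy equality implies the adjoint identity: the Stieltjes transform of c at t is the defect of A
B⁻¹ A for A = σ, B = ρ + tσ, hence nonnegative (`subTr_map_inv_le`). A vanishing log moment forces
the transform, and then the second moment, to vanish (`sum_sq_eq_zero_of_sum_log_eq_zero`). That
defect dominates a faithful weighted square norm of T*(T(σ)⁻¹T(ρ)) - σ⁻¹ρ (`subTr_sub_le`).

Conversely, the identity saturates the Schwarz inequality at W = T(σ)⁻¹T(ρ), so T* is multiplicative
on powers of W (`hsAdjoint_mul_of_schwarz_eq`). All moments of c then vanish, and by interpolation
so does its log moment. -/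

theorem tr_eq_sum_inner [FiniteDimensional ℂ H] (A : H →L[ℂ] H) :
    tr A = ∑ i, inner ℂ (stdOrthonormalBasis ℂ H i) (A (stdOrthonormalBasis ℂ H i)) := by
  simp only [tr, LinearMap.comp_apply, ContinuousLinearMap.coeLM_apply]
  rw [LinearMap.trace_eq_sum_inner _ (stdOrthonormalBasis ℂ H)]
  rfl

theorem tr_nonneg [FiniteDimensional ℂ H] {A : H →L[ℂ] H} (hA : 0 ≤ A) : 0 ≤ tr A := by
  rw [tr_eq_sum_inner]
  exact Finset.sum_nonneg fun i _ =>
    ((ContinuousLinearMap.nonneg_iff_isPositive A).mp hA).inner_nonneg_right _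

variable [CompleteSpace H]

/-- B is bounded below by r·1 with r > 0, and A is bounded above by ‖A‖·1. This lets a saturated
faithful weight control every other weight. -/
theorem exists_le_smul {B : H →L[ℂ] H} (hB : IsStrictlyPositive B) {A : H →L[ℂ] H}
    (hA : IsSelfAdjoint A) : ∃ c : ℝ, A ≤ c • B := by
  cases subsingleton_or_nontrivial (H →L[ℂ] H)
  · exact ⟨0, (Subsingleton.elim _ _).le⟩
  obtain ⟨r, hr, hrB⟩ := (CFC.exists_pos_algebraMap_le_iff hB.isSelfAdjoint).2
    fun x hx => hB.spectrum_pos hx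
  refine ⟨‖A‖ / r, hA.le_algebraMap_norm_self.trans ?_⟩
  calc algebraMap ℝ (H →L[ℂ] H) ‖A‖ = (‖A‖ / r) • algebraMap ℝ (H →L[ℂ] H) r := by
        rw [Algebra.algebraMap_eq_smul_one, Algebra.algebraMap_eq_smul_one, smul_smul,
          div_mul_cancel₀ _ hr.ne']
    _ ≤ (‖A‖ / r) • B := smul_le_smul_of_nonneg_left hrB (by positivity)

variable [FiniteDimensional ℂ H]

theorem tr_star_conj_nonneg {B : H →L[ℂ] H} (hB : 0 ≤ B) (X : H →L[ℂ] H) :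
    0 ≤ (tr (star X * B * X)).re :=
  (Complex.nonneg_iff.mp (tr_nonneg (star_left_conjugate_nonneg hB X))).1

/-- A strictly positive operator has a faithful weighted trace. -/
theorem eq_zero_of_tr_star_conj {B : H →L[ℂ] H} (hB : IsStrictlyPositive B) {X : H →L[ℂ] H}
    (h : (tr (star X * B * X)).re ≤ 0) : X = 0 := by
  obtain ⟨C, hC⟩ := CStarAlgebra.nonneg_iff_eq_star_mul_self.mp hB.nonneg
  have h0 : tr (star X * B * X) = 0 := by
    have := Complex.nonneg_iff.mp (tr_nonneg (star_left_conjugate_nonneg hB.nonneg X))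
    exact Complex.ext (le_antisymm h this.1) this.2.symm
  have h1 : C * X = 0 := hsInner_self_eq_zero (by
    rw [hsInner, ← h0, hC]; simp only [star_mul, mul_assoc])
  have h2 : B * X = 0 := by rw [hC, mul_assoc, h1, mul_zero]
  exact hB.isUnit.mul_left_cancel (by rw [h2, mul_zero])

end Operators

/-! ### Weighted Schwarz inequality, monotonicity of tr[A B⁻¹ A], multiplicative domain. -/

section MatrixAlgebras

variable {H : Type*} [NormedAddCommGroup H] [InnerProductSpace ℂ H] [CompleteSpace H]
variable {K : Type*} [NormedAddCommGroup K] [InnerProductSpace ℂ K] [CompleteSpace K]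
variable {M : StarSubalgebra ℂ (H →L[ℂ] H)} {N : StarSubalgebra ℂ (K →L[ℂ] K)}

/-- The block matrix is R* B R for the row R = (X, 1), so its quadratic form at v is that of B at X
v₀ + v₁. -/
theorem blockPosSemidef_of_nonneg {B : M} (hB : 0 ≤ (B : H →L[ℂ] H)) (X : M) :
    BlockPosSemidef !![star X * B * X, star X * B; B * X, B] := by
  intro v
  have h := ((ContinuousLinearMap.nonneg_iff_isPositive _).mp hB).inner_nonneg_right
    ((X : H →L[ℂ] H) (v 0) + v 1)
  refine h.trans_eq ?_
  simp [Fin.sum_univ_two, ContinuousLinearMap.star_eq_adjoint, inner_add_left, inner_add_right,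
    ContinuousLinearMap.adjoint_inner_right]
  ring

/-- A positive block form takes real values; removing its diagonal terms leaves a real off-diagonal
sum, and replacing u by iu gives the other half of the identity. -/
theorem map_star_of_isCompletelyPositive {T : M →ₗ[ℂ] N} (hcp : IsCompletelyPositive T) (X : M) :
    T (star X) = star (T X) := by
  have h := hcp 2 _ (blockPosSemidef_of_nonneg (B := (1 : M)) (by simp) X)
  have key : ∀ u w : K, (inner ℂ u ((T (star X) : K →L[ℂ] K) w)).im +
      (inner ℂ w ((T X : K →L[ℂ] K) u)).im = 0 := by
    intro u w
    have h1 := (Complex.nonneg_iff.mp (h ![u, w])).2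
    have h2 := (Complex.nonneg_iff.mp (h ![u, 0])).2
    have h3 := (Complex.nonneg_iff.mp (h ![0, w])).2
    simp [Fin.sum_univ_two] at h1 h2 h3
    linarith
  refine Subtype.ext (ContinuousLinearMap.ext fun w => ext_inner_left ℂ fun u => ?_)
  have h1 := key u w
  have h2 := key (Complex.I • u) w
  have h3 : inner ℂ u (((star (T X) : N) : K →L[ℂ] K) w) =
      (starRingEnd ℂ) (inner ℂ w ((T X : K →L[ℂ] K) u)) := by
    simp [ContinuousLinearMap.star_eq_adjoint, ContinuousLinearMap.adjoint_inner_right]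
  rw [h3]
  simp at h2
  apply Complex.ext
  · rw [Complex.conj_re]; linarith
  · rw [Complex.conj_im]; linarith

/-- The trace of the ambient operators, restricted to a matrix algebra. -/
noncomputable def subTr (M : StarSubalgebra ℂ (H →L[ℂ] H)) : M →ₗ[ℂ] ℂ where
  toFun X := tr (X : H →L[ℂ] H)
  map_add' X Y := map_add tr (X : H →L[ℂ] H) Y
  map_smul' c X := map_smul tr c (X : H →L[ℂ] H)

theorem subTr_mul_comm (X Y : M) : subTr M (X * Y) = subTr M (Y * X) :=
  tr_mul_comm (X : H →L[ℂ] H) Y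

variable [FiniteDimensional ℂ H] [FiniteDimensional ℂ K]

/-- Compress the block matrix by the column (1, -Y): test it on (e, -Y e) and sum over an
orthonormal basis. -/
theorem tr_nonneg_of_blockPosSemidef {a b c d : N} (h : BlockPosSemidef !![a, b; c, d]) (Y : N) :
    0 ≤ (tr ((a - b * Y - star Y * c + star Y * d * Y : N) : K →L[ℂ] K)).re := by
  refine (Complex.nonneg_iff.mp ?_).1
  rw [tr_eq_sum_inner]
  refine Finset.sum_nonneg fun i _ => ?_
  refine (h ![stdOrthonormalBasis ℂ K i,
    -(Y : K →L[ℂ] K) (stdOrthonormalBasis ℂ K i)]).trans_eq ?_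
  simp [Fin.sum_univ_two, ContinuousLinearMap.star_eq_adjoint,
    ContinuousLinearMap.adjoint_inner_right]
  ring

theorem subTr_star (X : M) : subTr M (star X) = star (subTr M X) :=
  tr_star (X : H →L[ℂ] H)

theorem subTr_re_star (X : M) : (subTr M (star X)).re = (subTr M X).re := by
  rw [subTr_star]; simp

theorem hsAdjoint_tr {T : M →ₗ[ℂ] N} (hcp : IsCompletelyPositive T) (X : M) (Y : N) :
    subTr N (T X * Y) = subTr M (X * hsAdjoint T Y) := by
  have h := hsInner_hsAdjoint T (star X) Y
  rw [map_star_of_isCompletelyPositive hcp] at h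
  simp only [hsInner, StarMemClass.coe_star, star_star] at h
  exact h

theorem eq_of_subTr_mul_eq {Z Z' : M} (h : ∀ X : M, subTr M (X * Z) = subTr M (X * Z')) : Z = Z' :=
  hsInner_ext fun X => h (star X)

theorem hsAdjoint_one {T : M →ₗ[ℂ] N} (hcp : IsCompletelyPositive T) (htp : IsTracePreserving T) :
    hsAdjoint T 1 = 1 :=
  eq_of_subTr_mul_eq fun X => by
    rw [← hsAdjoint_tr hcp, mul_one, mul_one]; exact htp X

theorem hsAdjoint_star {T : M →ₗ[ℂ] N} (hcp : IsCompletelyPositive T) (Y : N) :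
    hsAdjoint T (star Y) = star (hsAdjoint T Y) := by
  refine eq_of_subTr_mul_eq fun X => ?_
  have h := congrArg star (hsAdjoint_tr hcp (star X) Y)
  rw [← subTr_star, ← subTr_star, map_star_of_isCompletelyPositive hcp, star_mul, star_mul,
    star_star, star_star, subTr_mul_comm, subTr_mul_comm _ X] at h
  rw [← hsAdjoint_tr hcp, h]

/-- The Schwarz inequality for the adjoint of a trace preserving completely positive map, weighted
by a positive operator `B`. -/
theorem subTr_hsAdjoint_schwarz {T : M →ₗ[ℂ] N} (hcp : IsCompletelyPositive T)
    (htp : IsTracePreserving T) {B : M} (hB : 0 ≤ (B : H →L[ℂ] H)) (Y : N) :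
    (subTr M (star (hsAdjoint T Y) * B * hsAdjoint T Y)).re ≤ (subTr N (star Y * T B * Y)).re := by
  set X := hsAdjoint T Y with hX
  have h := hcp 2 _ (blockPosSemidef_of_nonneg hB X)
  have h' : BlockPosSemidef !![T (star X * B * X), T (star X * B); T (B * X), T B] := by
    convert h using 1
    ext i j; fin_cases i <;> fin_cases j <;> rfl
  -- Since X = T*(Y), both cross terms have real part tr[X* B X], so the compressed trace is tr[Y*
  -- T(B) Y] - tr[X* B X].
  have h1 : 0 ≤ (subTr N _).re := tr_nonneg_of_blockPosSemidef h' Y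
  have hBs : star B = B := Subtype.ext (IsSelfAdjoint.of_nonneg hB).star_eq
  have h2 : subTr N (T (star X * B) * Y) = subTr M (star X * B * X) := hsAdjoint_tr hcp _ _
  have h3 : (subTr N (star Y * T (B * X))).re = (subTr M (star X * B * X)).re := by
    rw [← subTr_re_star, ← h2, star_mul, star_star, ← map_star_of_isCompletelyPositive hcp,
      star_mul, hBs]
  have h4 : subTr N (T (star X * B * X)) = subTr M (star X * B * X) := htp _
  rw [map_add, map_sub, map_sub, h4, h2] at h1
  simp only [Complex.add_re, Complex.sub_re, h3] at h1
  linarith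

theorem star_eq_of_mul_eq_one {A : Type*} [Monoid A] [StarMul A] {B C : A} (hB : star B = B)
    (hC : B * C = 1) : star C = C := by
  have h : star C * B = 1 := by rw [← hB, ← star_mul, hC, star_one]
  calc star C = star C * (B * C) := by rw [hC, mul_one]
    _ = C := by rw [← mul_assoc, h, one_mul]

/-- The defect in `tr[T(A) T(B)⁻¹ T(A)] ≤ tr[A B⁻¹ A]` bounds the distance between
`T*(T(B)⁻¹ T(A))` and `B⁻¹ A`. -/
theorem subTr_sub_le {T : M →ₗ[ℂ] N} (hcp : IsCompletelyPositive T) (htp : IsTracePreserving T)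
    {A B C : M} {D : N} (hA : star A = A) (hB : 0 ≤ (B : H →L[ℂ] H))
    (hC : B * C = 1) (hD : T B * D = 1) :
    (subTr M (star (hsAdjoint T (D * T A) - C * A) * B * (hsAdjoint T (D * T A) - C * A))).re ≤
      (subTr M (A * C * A)).re - (subTr N (T A * D * T A)).re := by
  have hBs : star B = B := Subtype.ext (IsSelfAdjoint.of_nonneg hB).star_eq
  have hTA : star (T A) = T A := by rw [← map_star_of_isCompletelyPositive hcp, hA]
  have hTB : star (T B) = T B := by rw [← map_star_of_isCompletelyPositive hcp, hBs]
  have hCs := star_eq_of_mul_eq_one hBs hC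
  have hDs := star_eq_of_mul_eq_one hTB hD
  have hCB : C * B = 1 := by rw [← hCs, ← hBs, ← star_mul, hC, star_one]
  have h1 := subTr_hsAdjoint_schwarz hcp htp hB (D * T A)
  have h2 : star (D * T A) * T B * (D * T A) = T A * D * T A := by
    rw [star_mul, hTA, hDs]
    calc T A * D * T B * (D * T A) = T A * D * (T B * D) * T A := by noncomm_ring
      _ = _ := by rw [hD, mul_one]
  have h3 := hsAdjoint_tr hcp A (D * T A)
  rw [h2] at h1
  set S := hsAdjoint T (D * T A)
  have h4 : (subTr M (star S * A)).re = (subTr M (A * S)).re := by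
    rw [← subTr_re_star, star_mul, star_star, hA]
  -- Completing the square: C = B⁻¹, and the cross terms are the ones the adjoint relation computes.
  have h5 : star (S - C * A) * B * (S - C * A) =
      star S * B * S - star S * A - A * S + A * C * A := by
    rw [star_sub, star_mul, hA, hCs]
    calc (star S - A * C) * B * (S - C * A)
        = star S * B * S - star S * (B * C) * A - A * (C * B) * S + A * (C * B) * C * A := by
          noncomm_ring
      _ = _ := by rw [hC, hCB]; simp only [mul_one]
  rw [h5, map_add, map_sub, map_sub]
  simp only [Complex.add_re, Complex.sub_re, h4, ← h3]
  rw [mul_assoc (T A)] at h1 ⊢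
  linarith

theorem subTr_map_inv_le {T : M →ₗ[ℂ] N} (hcp : IsCompletelyPositive T) (htp : IsTracePreserving T)
    {A B C : M} {D : N} (hA : star A = A) (hB : 0 ≤ (B : H →L[ℂ] H))
    (hC : B * C = 1) (hD : T B * D = 1) :
    (subTr N (T A * D * T A)).re ≤ (subTr M (A * C * A)).re := by
  have h := subTr_sub_le hcp htp hA hB hC hD
  have h0 : 0 ≤ (subTr M (star (hsAdjoint T (D * T A) - C * A) * B *
      (hsAdjoint T (D * T A) - C * A))).re := tr_star_conj_nonneg hB _
  exact sub_nonneg.mp (h0.trans h)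

/-- With zero defect the square weighted by B has trace at most 0, and B is faithful. -/
theorem hsAdjoint_eq_of_subTr_eq {T : M →ₗ[ℂ] N} (hcp : IsCompletelyPositive T)
    (htp : IsTracePreserving T) {A B C : M} {D : N} (hA : star A = A)
    (hB : IsStrictlyPositive (B : H →L[ℂ] H)) (hC : B * C = 1) (hD : T B * D = 1)
    (h : (subTr M (A * C * A)).re = (subTr N (T A * D * T A)).re) :
    hsAdjoint T (D * T A) = C * A := by
  have h1 := subTr_sub_le hcp htp hA hB.nonneg hC hD
  rw [h, sub_self] at h1
  exact sub_eq_zero.mp (Subtype.ext (eq_zero_of_tr_star_conj hB h1))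

/-- Positive elements span M: X + X* becomes positive after adding its norm times 1, and using iX as
well separates X from X*. -/
theorem eq_zero_of_subTr_nonneg_mul {E : M}
    (h : ∀ B : M, 0 ≤ (B : H →L[ℂ] H) → subTr M (B * E) = 0) : E = 0 := by
  have h1 : ∀ X : M, subTr M (X * E) + subTr M (star X * E) = 0 := by
    intro X
    have hsa : IsSelfAdjoint ((X + star X : M) : H →L[ℂ] H) :=
      congrArg Subtype.val (IsSelfAdjoint.add_star_self X)
    set c : ℝ := ‖((X + star X : M) : H →L[ℂ] H)‖
    have hle := sub_nonneg.mpr hsa.neg_algebraMap_norm_le_self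
    have h2 := h (X + star X + (c : ℂ) • 1) (by
      refine hle.trans_eq ?_
      rw [sub_neg_eq_add, Algebra.algebraMap_eq_smul_one]
      simp [c])
    have h3 := h 1 zero_le_one
    rw [one_mul] at h3
    rw [add_mul, add_mul, smul_mul_assoc, one_mul, map_add, map_add, map_smul, h3, smul_zero,
      add_zero] at h2
    exact h2
  refine eq_of_subTr_mul_eq fun X => ?_
  have h2 := h1 X
  have h3 := h1 (Complex.I • X)
  rw [star_smul, smul_mul_assoc, smul_mul_assoc, map_smul, map_smul] at h3
  simp only [smul_eq_mul, Complex.star_def, Complex.conj_I] at h3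
  have h4 : subTr M (X * E) - subTr M (star X * E) = 0 := by
    refine (mul_eq_zero.mp ?_).resolve_left Complex.I_ne_zero
    linear_combination h3
  rw [mul_zero, map_zero]
  linear_combination (h2 + h4) / 2

/-- The values at t = ±1 give p ≥ -r ≥ 0, so the discriminant bound q² ≤ 4pr ≤ 0 applies. -/
theorem eq_zero_of_forall_quadratic_nonneg {p q r : ℝ} (hr : r ≤ 0)
    (h : ∀ t : ℝ, 0 ≤ p * (t * t) + q * t + r) : q = 0 := by
  have h1 := discrim_le_zero h
  have h2 : 0 ≤ p := by
    have h3 := h 1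
    have h4 := h (-1)
    linarith
  rw [discrim] at h1
  nlinarith [mul_nonneg h2 (neg_nonneg.mpr hr)]

/-- If the Schwarz inequality for `T*` is saturated at `W` for one faithful weight, then `W` is in
the multiplicative domain of `T*`. -/
theorem hsAdjoint_mul_of_schwarz_eq {T : M →ₗ[ℂ] N} (hcp : IsCompletelyPositive T)
    (htp : IsTracePreserving T) {σ : M} (hσ : IsStrictlyPositive (σ : H →L[ℂ] H)) {W : N}
    (hW : (subTr N (star W * T σ * W)).re =
      (subTr M (star (hsAdjoint T W) * σ * hsAdjoint T W)).re) (Y : N) :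
    hsAdjoint T (W * Y) = hsAdjoint T W * hsAdjoint T Y := by
  have hq : ∀ B : M, 0 ≤ (B : H →L[ℂ] H) → (subTr N (star W * T B * W)).re ≤
      (subTr M (star (hsAdjoint T W) * B * hsAdjoint T W)).re := by
    intro B hB
    obtain ⟨c, hc⟩ := exists_le_smul hσ (IsSelfAdjoint.of_nonneg hB)
    -- The weight cσ - B is positive and σ is saturated, so Schwarz for it is the reverse inequality
    -- for B.
    have h := subTr_hsAdjoint_schwarz hcp htp (B := (c : ℂ) • σ - B)
      (by simpa using hc) W
    simp only [map_sub, map_smul, mul_sub, sub_mul, mul_smul_comm, smul_mul_assoc, Complex.sub_re,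
      smul_eq_mul, Complex.re_ofReal_mul, hW] at h
    linarith
  have hre : ∀ B : M, 0 ≤ (B : H →L[ℂ] H) → ∀ Y : N,
      (subTr M (B * (hsAdjoint T (W * Y) - hsAdjoint T W * hsAdjoint T Y))).re = 0 := by
    intro B hB Y
    have hBs : star B = B := Subtype.ext (IsSelfAdjoint.of_nonneg hB).star_eq
    have hTB : star (T B) = T B := by rw [← map_star_of_isCompletelyPositive hcp, hBs]
    set S := hsAdjoint T
    set p := (subTr N (Y * T B * star Y)).re - (subTr M (S Y * B * star (S Y))).re
    set r := (subTr N (star W * T B * W)).re - (subTr M (star (S W) * B * S W)).re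
    have hr : r ≤ 0 := sub_nonpos.mpr (hq B hB)
    have hS : ∀ t : ℝ, S (W + (t : ℂ) • star Y) = S W + (t : ℂ) • star (S Y) := fun t => by
      rw [map_add, map_smul, hsAdjoint_star hcp]
    have h1 : (subTr N (star W * T B * star Y)).re = (subTr M (B * S (W * Y))).re := by
      rw [← hsAdjoint_tr hcp, ← mul_assoc, subTr_mul_comm, ← subTr_re_star]
      simp only [star_mul, star_star, hTB, mul_assoc]
    have h2 : (subTr N (Y * T B * W)).re = (subTr M (B * S (W * Y))).re := by
      rw [← hsAdjoint_tr hcp, ← mul_assoc, subTr_mul_comm _ Y, mul_assoc]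
    have h3 : (subTr M (star (S W) * B * star (S Y))).re = (subTr M (B * (S W * S Y))).re := by
      rw [← mul_assoc, subTr_mul_comm _ (S Y), ← subTr_re_star]
      simp only [star_mul, star_star, hBs, mul_assoc]
    have h4 : (subTr M (S Y * B * S W)).re = (subTr M (B * (S W * S Y))).re := by
      rw [← mul_assoc, subTr_mul_comm _ (S Y), mul_assoc]
    -- Perturb W to W + tY*: the Schwarz defect is a nonnegative quadratic in t with constant term
    -- at most 0, so its linear coefficient vanishes.
    have h5 := eq_zero_of_forall_quadratic_nonneg (p := p)
      (q := 2 * (subTr M (B * (S (W * Y) - S W * S Y))).re) hr (fun t => by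
        have h := subTr_hsAdjoint_schwarz hcp htp hB (W + (t : ℂ) • star Y)
        rw [hS] at h
        simp only [star_add, star_smul, star_star, Complex.star_def, Complex.conj_ofReal, map_add,
          map_smul, mul_add, add_mul, mul_smul_comm, smul_mul_assoc, Complex.add_re,
          smul_eq_mul, Complex.re_ofReal_mul, h1, h2, h3, h4] at h
        simp only [mul_sub, map_sub, Complex.sub_re, p, r]
        linarith)
    linarith
  refine sub_eq_zero.mp (eq_zero_of_subTr_nonneg_mul fun B hB => ?_)
  apply Complex.ext
  · exact hre B hB Y
  · have h := hre B hB (Complex.I • Y)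
    rw [mul_smul_comm, map_smul, map_smul, mul_smul_comm, ← smul_sub, mul_smul_comm, map_smul,
      smul_eq_mul, Complex.I_mul_re] at h
    simpa using h

theorem hsAdjoint_pow_of_schwarz_eq {T : M →ₗ[ℂ] N} (hcp : IsCompletelyPositive T)
    (htp : IsTracePreserving T) {σ : M} (hσ : IsStrictlyPositive (σ : H →L[ℂ] H)) {W : N}
    (hW : (subTr N (star W * T σ * W)).re =
      (subTr M (star (hsAdjoint T W) * σ * hsAdjoint T W)).re) (n : ℕ) :
    hsAdjoint T (W ^ n) = hsAdjoint T W ^ n := by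
  induction n with
  | zero => rw [pow_zero, pow_zero, hsAdjoint_one hcp htp]
  | succ n ih => rw [pow_succ', pow_succ', hsAdjoint_mul_of_schwarz_eq hcp htp hσ hW, ih]

/-- If `T*(T(σ)⁻¹ T(ρ)) = σ⁻¹ ρ`, then `tr[σ (σ⁻¹ ρ)ⁿ]` is preserved by `T`. -/
theorem subTr_mul_pow_eq {T : M →ₗ[ℂ] N} (hcp : IsCompletelyPositive T)
    (htp : IsTracePreserving T) {σ ρ C : M} {D : N} (hσ : IsStrictlyPositive (σ : H →L[ℂ] H))
    (hρ : star ρ = ρ) (hC : σ * C = 1) (hD : T σ * D = 1)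
    (h : hsAdjoint T (D * T ρ) = C * ρ) (n : ℕ) :
    subTr N (T σ * (D * T ρ) ^ n) = subTr M (σ * (C * ρ) ^ n) := by
  have hTρ : star (T ρ) = T ρ := by rw [← map_star_of_isCompletelyPositive hcp, hρ]
  rw [hsAdjoint_tr hcp, hsAdjoint_pow_of_schwarz_eq hcp htp hσ, h]
  -- The remaining goal is Schwarz saturation at W = D T(ρ): both sides reduce to Re tr[ρ C ρ].
  rw [mul_assoc, mul_assoc, ← mul_assoc (T σ), hD, h, ← mul_assoc σ, hC, one_mul, one_mul,
    ← subTr_re_star, star_mul, star_star, hTρ, hsAdjoint_tr hcp, h,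
    ← subTr_re_star, star_mul, hρ]

end MatrixAlgebras

/-! ### A moment argument with the Stieltjes transform. -/

section Scalar

open Filter Topology

/-- A signed measure with finite support in `(0, ∞)`, vanishing total mass and vanishing first and
logarithmic moments, whose Stieltjes transform is nonnegative, has vanishing second moment. -/
theorem sum_sq_eq_zero_of_sum_log_eq_zero {u : Finset ℝ} (hu : ∀ x ∈ u, 0 < x) {c : ℝ → ℝ}
    (h0 : ∑ x ∈ u, c x = 0) (h1 : ∑ x ∈ u, c x * x = 0)
    (hlog : ∑ x ∈ u, c x * Real.log x = 0)
    (hpos : ∀ t : ℝ, 0 < t → 0 ≤ ∑ x ∈ u, c x * (x + t)⁻¹) :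
    ∑ x ∈ u, c x * x ^ 2 = 0 := by
  -- G is a primitive of the Stieltjes transform, hence monotone. G(0) = 0 is the log moment, and G
  -- → 0 at infinity because the total mass is 0, so G vanishes on [0, ∞).
  set G : ℝ → ℝ := fun t => ∑ x ∈ u, c x * Real.log (x + t) with hG
  have hderiv : ∀ t : ℝ, 0 ≤ t → HasDerivAt G (∑ x ∈ u, c x * (x + t)⁻¹) t := fun t ht =>
    HasDerivAt.fun_sum fun x hx => by
      have hxt : x + t ≠ 0 := by linarith [hu x hx] |> ne_of_gt
      have h := ((hasDerivAt_id t).const_add x).log hxt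
      simpa using h.const_mul (c x)
  have hmono : MonotoneOn G (Set.Ici 0) := by
    refine monotoneOn_of_deriv_nonneg (convex_Ici 0)
      (fun t ht => (hderiv t ht).continuousAt.continuousWithinAt) (fun t ht => ?_) fun t ht => ?_
    · rw [interior_Ici] at ht
      exact (hderiv t ht.le).differentiableAt.differentiableWithinAt
    · rw [interior_Ici] at ht
      rw [(hderiv t ht.le).deriv]
      exact hpos t ht
  have hlim : Tendsto G atTop (𝓝 0) := by
    have h2 : Tendsto (fun t : ℝ => ∑ x ∈ u, c x * Real.log (1 + x * t⁻¹)) atTop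
        (𝓝 (∑ x ∈ u, c x * Real.log (1 + x * 0))) := by
      refine tendsto_finsetSum _ fun x _ => Tendsto.const_mul _ (Tendsto.log ?_ (by simp))
      exact (tendsto_inv_atTop_zero.const_mul x).const_add 1
    simp only [mul_zero, add_zero, Real.log_one, Finset.sum_const_zero] at h2
    refine h2.congr' ?_
    filter_upwards [eventually_gt_atTop 0] with t ht
    have h3 : ∀ x ∈ u, c x * Real.log (1 + x * t⁻¹) =
        c x * Real.log (x + t) - c x * Real.log t := fun x hx => by
      rw [← mul_sub, ← Real.log_div (by linarith [hu x hx] |> ne_of_gt) ht.ne']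
      congr 2
      field_simp
      ring
    rw [Finset.sum_congr rfl h3, Finset.sum_sub_distrib, ← Finset.sum_mul, h0, zero_mul, sub_zero]
  have hzero : ∀ t : ℝ, 0 ≤ t → G t = 0 := fun t ht => by
    refine le_antisymm (ge_of_tendsto hlim ?_) ?_
    · filter_upwards [eventually_ge_atTop t] with s hs
      exact hmono ht (ht.trans hs) hs
    · have h2 := hmono (Set.mem_Ici.mpr le_rfl) ht ht
      simpa [hG, hlog] using h2
  have hF : ∀ t : ℝ, 0 < t → ∑ x ∈ u, c x * (x + t)⁻¹ = 0 := fun t ht => by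
    refine (hderiv t ht.le).unique ((hasDerivAt_const t (0 : ℝ)).congr_of_eventuallyEq ?_)
    filter_upwards [eventually_gt_nhds ht] with s hs
    exact hzero s hs.le
  -- From x²/(1 + x/t) = tx - t² + t³/(x + t), this sum is identically 0 for t > 0, while its limit
  -- is the second moment.
  have hlim2 : Tendsto (fun t : ℝ => ∑ x ∈ u, c x * (x ^ 2 * (1 + x * t⁻¹)⁻¹)) atTop
      (𝓝 (∑ x ∈ u, c x * (x ^ 2 * (1 + x * 0)⁻¹))) := by
    refine tendsto_finsetSum _ fun x _ => Tendsto.const_mul _ (Tendsto.const_mul _ ?_)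
    exact ((tendsto_inv_atTop_zero.const_mul x).const_add 1).inv₀ (by simp)
  simp only [mul_zero, add_zero, inv_one, mul_one] at hlim2
  refine tendsto_nhds_unique hlim2 (tendsto_const_nhds.congr' ?_)
  filter_upwards [eventually_gt_atTop 0] with t ht
  have h3 : ∀ x ∈ u, c x * (x ^ 2 * (1 + x * t⁻¹)⁻¹) =
      (c x * x) * t - c x * t ^ 2 + t ^ 3 * (c x * (x + t)⁻¹) := fun x hx => by
    have h4 : x + t ≠ 0 := by linarith [hu x hx] |> ne_of_gt
    have h5 : 1 + x * t⁻¹ = (x + t) * t⁻¹ := by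
      rw [add_mul, mul_inv_cancel₀ ht.ne', add_comm]
    rw [h5, mul_inv, inv_inv]
    linear_combination (c x * t * (x - t)) * mul_inv_cancel₀ h4
  rw [Finset.sum_congr rfl h3, Finset.sum_add_distrib, Finset.sum_sub_distrib, ← Finset.sum_mul,
    ← Finset.sum_mul, ← Finset.mul_sum, h0, h1, hF t ht]
  ring

end Scalar

/-! ### Functional calculus of σ^{-1/2} ρ σ^{-1/2}. -/

section Spectral

variable {H : Type*} [NormedAddCommGroup H] [InnerProductSpace ℂ H]

theorem finite_spectrum_real [FiniteDimensional ℂ H] (A : H →L[ℂ] H) : (spectrum ℝ A).Finite := by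
  have h : (spectrum ℂ A).Finite := by
    rw [← AlgEquiv.spectrum_eq (Module.End.toContinuousLinearMap H).symm A]
    exact Module.End.finite_spectrum _
  rw [← spectrum.preimage_algebraMap ℂ]
  exact h.preimage (algebraMap ℝ ℂ).injective.injOn

variable [CompleteSpace H]

/-- The operator `σ^{-1/2} ρ σ^{-1/2}`. -/
noncomputable def relOp (σ ρ : H →L[ℂ] H) : H →L[ℂ] H :=
  σ ^ (-(1 / 2) : ℝ) * ρ * σ ^ (-(1 / 2) : ℝ)

variable {σ ρ : H →L[ℂ] H}

theorem relOp_isStrictlyPositive (hσ : IsStrictlyPositive σ) (hρ : IsStrictlyPositive ρ) :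
    IsStrictlyPositive (relOp σ ρ) := by
  have hs : IsStrictlyPositive (σ ^ (-(1 / 2) : ℝ)) := hσ.rpow _ _
  refine ⟨?_, (hs.isUnit.mul hρ.isUnit).mul hs.isUnit⟩
  exact hs.isSelfAdjoint.conjugate_nonneg hρ.nonneg

theorem exists_sqrt (hσ : IsStrictlyPositive σ) : ∃ r : H →L[ℂ] H, r * r = σ ∧
    r * σ ^ (-(1 / 2) : ℝ) = 1 ∧ σ ^ (-(1 / 2) : ℝ) * r = 1 := by
  refine ⟨σ ^ (1 / 2 : ℝ), ?_, CFC.rpow_mul_rpow_neg _ hσ, CFC.rpow_neg_mul_rpow _ hσ⟩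
  rw [← CFC.rpow_add hσ.isUnit, add_halves, CFC.rpow_one σ hσ.nonneg]

theorem bsEntropy_eq_relOp (σ ρ : H →L[ℂ] H) :
    bsEntropy σ ρ = -(tr (σ * cfc Real.log (relOp σ ρ))).re := rfl

/-- σ⁻¹ρ = σ^{-1/2} Γ σ^{1/2} is similar to Γ = `relOp σ ρ`; the outer factors are absorbed by
cyclicity of the trace. -/
theorem tr_mul_cfc_pow (hσ : IsStrictlyPositive σ) (hρ : IsStrictlyPositive ρ) {C : H →L[ℂ] H}
    (hC : σ * C = 1) (n : ℕ) :
    tr (σ * cfc (fun x : ℝ => x ^ n) (relOp σ ρ)) = tr (σ * (C * ρ) ^ n) := by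
  rw [cfc_pow_id _ n (relOp_isStrictlyPositive hσ hρ).isSelfAdjoint]
  obtain ⟨r, hr, hrs, hsr⟩ := exists_sqrt hσ
  set s := σ ^ (-(1 / 2) : ℝ) with hs
  have hCs : C = s * s := by
    calc C = s * (s * r) * r * C := by rw [hsr, mul_one, hsr, one_mul]
      _ = s * s * ((r * r) * C) := by noncomm_ring
      _ = s * s := by rw [hr, hC, mul_one]
  have h : ∀ n : ℕ, (C * ρ) ^ n = s * relOp σ ρ ^ n * r := by
    intro n
    induction n with
    | zero => simp [hsr]
    | succ n ih =>
      rw [pow_succ, ih, pow_succ, hCs, relOp, ← hs]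
      calc s * (s * ρ * s) ^ n * r * (s * s * ρ)
          = s * (s * ρ * s) ^ n * (r * s) * s * ρ := by noncomm_ring
        _ = s * (s * ρ * s) ^ n * s * ρ * (s * r) := by rw [hrs, hsr, mul_one, mul_one]
        _ = _ := by noncomm_ring
  rw [h]
  calc tr (σ * relOp σ ρ ^ n) = tr (r * (r * relOp σ ρ ^ n)) := by rw [← mul_assoc, hr]
    _ = tr (r * relOp σ ρ ^ n * r) := tr_mul_comm _ _
    _ = tr (r * (r * s) * relOp σ ρ ^ n * r) := by rw [hrs, mul_one]
    _ = _ := by rw [← mul_assoc r r s, hr]; simp only [mul_assoc]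

variable [FiniteDimensional ℂ H]

/-- On a finite set containing the spectrum, the continuous functional calculus is a weighted sum
of the values of the function. -/
theorem exists_re_tr_mul_cfc_eq_sum (S : H →L[ℂ] H) {A : H →L[ℂ] H} {u : Finset ℝ}
    (hu : spectrum ℝ A ⊆ u) :
    ∃ c : ℝ → ℝ, ∀ f : ℝ → ℝ, (tr (S * cfc f A)).re = ∑ x ∈ u, c x * f x := by
  classical
  -- The weight at x is the trace against the spectral projection of A at x, which is 0 off the
  -- spectrum.
  refine ⟨fun x => (tr (S * cfc (fun y => if y = x then (1 : ℝ) else 0) A)).re, fun f => ?_⟩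
  have hcont : ∀ g : ℝ → ℝ, ContinuousOn g (spectrum ℝ A) := fun g =>
    (finite_spectrum_real A).continuousOn g
  have h : cfc f A = ∑ x ∈ u, f x • cfc (fun y => if y = x then (1 : ℝ) else 0) A := by
    have h1 : ∀ x ∈ u, f x • cfc (fun y => if y = x then (1 : ℝ) else 0) A =
        cfc (fun y => f x • if y = x then (1 : ℝ) else 0) A := fun x _ =>
      (cfc_smul (f x) _ A (hcont _)).symm
    rw [Finset.sum_congr rfl h1, ← cfc_sum _ A u fun x _ => hcont _]
    refine cfc_congr fun y hy => ?_
    have hy' : y ∈ u := hu hy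
    simp [Finset.sum_apply, hy']
  rw [h, Finset.mul_sum, map_sum, Complex.re_sum]
  refine Finset.sum_congr rfl fun x _ => ?_
  have h2 : S * (f x • cfc (fun y => if y = x then (1 : ℝ) else 0) A) =
      ((f x : ℝ) : ℂ) • (S * cfc (fun y => if y = x then (1 : ℝ) else 0) A) := by
    rw [mul_smul_comm]; rfl
  rw [h2, map_smul, smul_eq_mul, Complex.re_ofReal_mul, mul_comm]

/-- Γ + t = σ^{-1/2}(ρ + tσ)σ^{-1/2}, so its inverse is σ^{1/2}(ρ + tσ)⁻¹σ^{1/2}. This turns the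
Stieltjes transform into an A B⁻¹ A trace. -/
theorem tr_mul_cfc_resolvent (hσ : IsStrictlyPositive σ) (hρ : IsStrictlyPositive ρ) {t : ℝ}
    (ht : 0 < t) {C : H →L[ℂ] H} (hC : (ρ + (t : ℂ) • σ) * C = 1) :
    tr (σ * cfc (fun x : ℝ => (x + t)⁻¹) (relOp σ ρ)) = tr (σ * C * σ) := by
  have hΓ := relOp_isStrictlyPositive hσ hρ
  have hne : ∀ x ∈ spectrum ℝ (relOp σ ρ), x + t ≠ 0 := fun x hx =>
    (add_pos (hΓ.spectrum_pos hx) ht).ne'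
  have hcont : ContinuousOn (fun x : ℝ => (x + t)⁻¹) (spectrum ℝ (relOp σ ρ)) :=
    (finite_spectrum_real _).continuousOn _
  have h1 : cfc (fun x : ℝ => (x + t)⁻¹) (relOp σ ρ) * (relOp σ ρ + (t : ℂ) • 1) = 1 := by
    have h2 : cfc (fun x : ℝ => x + t) (relOp σ ρ) = relOp σ ρ + (t : ℂ) • 1 := by
      rw [cfc_add_const t (fun x => x) (relOp σ ρ), cfc_id' ℝ (relOp σ ρ),
        Algebra.algebraMap_eq_smul_one]
      rfl
    rw [← h2, ← cfc_mul _ _ (relOp σ ρ) hcont (by fun_prop), ← cfc_one ℝ (relOp σ ρ)]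
    exact cfc_congr fun x hx => inv_mul_cancel₀ (hne x hx)
  obtain ⟨r, hr, hrs, hsr⟩ := exists_sqrt hσ
  set F := cfc (fun x : ℝ => (x + t)⁻¹) (relOp σ ρ)
  rw [relOp] at h1
  set s := σ ^ (-(1 / 2) : ℝ)
  have h3 : s * ρ * s + (t : ℂ) • 1 = s * (ρ + (t : ℂ) • σ) * s := by
    have : s * σ * s = 1 := by
      rw [← hr]
      calc s * (r * r) * s = (s * r) * (r * s) := by noncomm_ring
        _ = 1 := by rw [hsr, hrs, mul_one]
    rw [mul_add, add_mul, mul_smul_comm, smul_mul_assoc, this]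
  have h4 : F = r * C * r := by
    rw [h3] at h1
    calc F = F * (s * ((ρ + (t : ℂ) • σ) * C) * r) := by rw [hC, mul_one, hsr, mul_one]
      _ = F * (s * (ρ + (t : ℂ) • σ) * (1 * (C * r))) := by noncomm_ring
      _ = F * (s * (ρ + (t : ℂ) • σ) * s) * (r * C * r) := by rw [← hsr]; noncomm_ring
      _ = _ := by rw [h1, one_mul]
  rw [h4]
  calc tr (σ * (r * C * r)) = tr (r * (r * r * C * r)) := by rw [← hr]; simp only [mul_assoc]
    _ = tr (r * r * C * r * r) := tr_mul_comm _ _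
    _ = _ := by rw [mul_assoc _ r r, hr]

end Spectral

/-- On a finite set every function agrees with its Lagrange interpolation polynomial. -/
theorem sum_mul_eq_zero_of_sum_pow_eq_zero {u : Finset ℝ} {c : ℝ → ℝ}
    (h : ∀ n : ℕ, ∑ x ∈ u, c x * x ^ n = 0) (f : ℝ → ℝ) : ∑ x ∈ u, c x * f x = 0 := by
  classical
  set p := Lagrange.interpolate u id f
  have hp : ∀ x ∈ u, c x * f x = ∑ n ∈ Finset.range (p.natDegree + 1), p.coeff n * (c x * x ^ n) :=
    fun x hx => by
      have h1 : p.eval (id x) = f x :=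
        Lagrange.eval_interpolate_at_node f Function.injective_id.injOn hx
      rw [← h1, Polynomial.eval_eq_sum_range, Finset.mul_sum]
      exact Finset.sum_congr rfl fun n _ => by simp only [id]; ring
  rw [Finset.sum_congr rfl hp, Finset.sum_comm]
  exact Finset.sum_eq_zero fun n _ => by rw [← Finset.mul_sum, h, mul_zero]

/-! ### The signed spectral measure and the equivalence. -/

section MatrixAlgebras

variable {H : Type*} [NormedAddCommGroup H] [InnerProductSpace ℂ H] [CompleteSpace H]
variable {K : Type*} [NormedAddCommGroup K] [InnerProductSpace ℂ K] [CompleteSpace K]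
variable [FiniteDimensional ℂ H] [FiniteDimensional ℂ K]

theorem exists_re_tr_cfc_relOp_sub_eq_sum {σ ρ : H →L[ℂ] H} {σ' ρ' : K →L[ℂ] K}
    (hσ : IsStrictlyPositive σ) (hρ : IsStrictlyPositive ρ)
    (hσ' : IsStrictlyPositive σ') (hρ' : IsStrictlyPositive ρ') :
    ∃ (u : Finset ℝ) (c : ℝ → ℝ), (∀ x ∈ u, 0 < x) ∧ ∀ f : ℝ → ℝ,
      (tr (σ * cfc f (relOp σ ρ))).re - (tr (σ' * cfc f (relOp σ' ρ'))).re =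
        ∑ x ∈ u, c x * f x := by
  classical
  have h1 := finite_spectrum_real (relOp σ ρ)
  have h2 := finite_spectrum_real (relOp σ' ρ')
  -- One support for both spectra, so that the two trace functionals subtract pointwise.
  set u := h1.toFinset ∪ h2.toFinset
  obtain ⟨a, ha⟩ := exists_re_tr_mul_cfc_eq_sum σ (A := relOp σ ρ) (u := u)
    fun x hx => by simp [u, hx]
  obtain ⟨b, hb⟩ := exists_re_tr_mul_cfc_eq_sum σ' (A := relOp σ' ρ') (u := u)
    fun x hx => by simp [u, hx]
  refine ⟨u, a - b, fun x hx => ?_, fun f => ?_⟩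
  · rcases Finset.mem_union.mp hx with hx | hx
    · exact (relOp_isStrictlyPositive hσ hρ).spectrum_pos (h1.mem_toFinset.mp hx)
    · exact (relOp_isStrictlyPositive hσ' hρ').spectrum_pos (h2.mem_toFinset.mp hx)
  · rw [ha, hb, ← Finset.sum_sub_distrib]
    exact Finset.sum_congr rfl fun x _ => by rw [Pi.sub_apply, sub_mul]

variable {M : StarSubalgebra ℂ (H →L[ℂ] H)} {N : StarSubalgebra ℂ (K →L[ℂ] K)}

theorem mul_ringInverse_of_isStrictlyPositive {A : M} (hA : IsStrictlyPositive (A : H →L[ℂ] H)) :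
    A * Ring.inverse A = 1 :=
  Subtype.ext (coe_ringInverse hA.isUnit).1

theorem hsAdjoint_eq_iff_bsEntropy_eq {T : M →ₗ[ℂ] N} (hcp : IsCompletelyPositive T)
    (htp : IsTracePreserving T) {σ ρ C : M} {D : N}
    (hσ : IsStrictlyPositive (σ : H →L[ℂ] H)) (hρ : IsStrictlyPositive (ρ : H →L[ℂ] H))
    (hTσ : IsStrictlyPositive (T σ : K →L[ℂ] K)) (hTρ : IsStrictlyPositive (T ρ : K →L[ℂ] K))
    (hC : σ * C = 1) (hD : T σ * D = 1) :
    bsEntropy (σ : H →L[ℂ] H) (ρ : H →L[ℂ] H) = bsEntropy (T σ : K →L[ℂ] K) (T ρ : K →L[ℂ] K) ↔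
      hsAdjoint T (D * T ρ) = C * ρ := by
  have hσs : star σ = σ := Subtype.ext hσ.isSelfAdjoint.star_eq
  have hρs : star ρ = ρ := Subtype.ext hρ.isSelfAdjoint.star_eq
  obtain ⟨u, c, hu, hc⟩ := exists_re_tr_cfc_relOp_sub_eq_sum hσ hρ hTσ hTρ
  have hpow : ∀ n : ℕ, ∑ x ∈ u, c x * x ^ n =
      (subTr M (σ * (C * ρ) ^ n)).re - (subTr N (T σ * (D * T ρ) ^ n)).re := fun n => by
    rw [← hc, tr_mul_cfc_pow hσ hρ (congrArg Subtype.val hC),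
      tr_mul_cfc_pow hTσ hTρ (congrArg Subtype.val hD)]
    rfl
  have htr : ∀ X : M, subTr N (T X) = subTr M X := htp
  have h0 : ∑ x ∈ u, c x = 0 := by
    have h := hpow 0
    simp only [pow_zero, mul_one, htr, sub_self] at h
    exact h
  have h1 : ∑ x ∈ u, c x * x = 0 := by
    have h := hpow 1
    rw [pow_one, pow_one, ← mul_assoc, hC, ← mul_assoc, hD, one_mul, one_mul, htr, sub_self] at h
    simpa using h
  have h2 : ∑ x ∈ u, c x * x ^ 2 =
      (subTr M (ρ * C * ρ)).re - (subTr N (T ρ * D * T ρ)).re := by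
    rw [hpow, pow_two, pow_two, mul_assoc C, ← mul_assoc σ, hC, one_mul, mul_assoc D,
      ← mul_assoc (T σ), hD, one_mul, mul_assoc, mul_assoc]
  have hlog : bsEntropy (σ : H →L[ℂ] H) (ρ : H →L[ℂ] H) =
      bsEntropy (T σ : K →L[ℂ] K) (T ρ : K →L[ℂ] K) ↔ ∑ x ∈ u, c x * Real.log x = 0 := by
    rw [← hc, bsEntropy_eq_relOp, bsEntropy_eq_relOp, neg_inj, sub_eq_zero]
  rw [hlog]
  constructor
  · intro h
    refine hsAdjoint_eq_of_subTr_eq hcp htp hρs hσ hC hD (sub_eq_zero.mp ?_)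
    rw [← h2]
    refine sum_sq_eq_zero_of_sum_log_eq_zero hu h0 h1 h fun t ht => ?_
    have htC : (0 : ℝ) ≤ t := ht.le
    have hB : IsStrictlyPositive ((ρ + (t : ℂ) • σ : M) : H →L[ℂ] H) :=
      hρ.add_nonneg (smul_nonneg htC hσ.nonneg : 0 ≤ t • (σ : H →L[ℂ] H))
    have hTB : IsStrictlyPositive ((T (ρ + (t : ℂ) • σ) : N) : K →L[ℂ] K) := by
      rw [map_add, map_smul]
      exact hTρ.add_nonneg (smul_nonneg htC hTσ.nonneg : 0 ≤ t • (T σ : K →L[ℂ] K))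
    have hE := mul_ringInverse_of_isStrictlyPositive hB
    have hE' := mul_ringInverse_of_isStrictlyPositive hTB
    have hE'' := hE'
    nth_rw 1 [map_add, map_smul] at hE''
    rw [← hc, tr_mul_cfc_resolvent hσ hρ ht (congrArg Subtype.val hE),
      tr_mul_cfc_resolvent hTσ hTρ ht (congrArg Subtype.val hE'')]
    -- Monotonicity of tr[A B⁻¹ A] with A = σ and B = ρ + tσ.
    exact sub_nonneg.mpr (subTr_map_inv_le hcp htp hσs hB.nonneg hE hE')
  · intro h
    refine sum_mul_eq_zero_of_sum_pow_eq_zero (fun n => ?_) Real.log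
    rw [hpow, subTr_mul_pow_eq hcp htp hσ hρs hC hD h, sub_self]

end MatrixAlgebras

end BSEntropy

theorem theorem4p2
    {H : Type*} [NormedAddCommGroup H] [InnerProductSpace ℂ H] [FiniteDimensional ℂ H]
    [CompleteSpace H]
    {K : Type*} [NormedAddCommGroup K] [InnerProductSpace ℂ K] [FiniteDimensional ℂ K]
    [CompleteSpace K]
    (M : StarSubalgebra ℂ (H →L[ℂ] H)) (N : StarSubalgebra ℂ (K →L[ℂ] K))
    (T : M →ₗ[ℂ] N)
    (hcp : BSEntropy.IsCompletelyPositive T) (htp : BSEntropy.IsTracePreserving T)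
    (σ ρ : M)
    (hσ : BSEntropy.IsPosDefState (σ : H →L[ℂ] H))
    (hρ : BSEntropy.IsPosDefState (ρ : H →L[ℂ] H))
    (hTσ : IsStrictlyPositive (T σ : K →L[ℂ] K))
    (hTρ : IsStrictlyPositive (T ρ : K →L[ℂ] K)) :
    BSEntropy.bsEntropy (σ : H →L[ℂ] H) (ρ : H →L[ℂ] H) =
        BSEntropy.bsEntropy (T σ : K →L[ℂ] K) (T ρ : K →L[ℂ] K) ↔
      BSEntropy.hsAdjoint T (Ring.inverse (T σ) * T ρ) = Ring.inverse σ * ρ :=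
  BSEntropy.hsAdjoint_eq_iff_bsEntropy_eq hcp htp hσ.1 hρ.1 hTσ hTρ
    (BSEntropy.mul_ringInverse_of_isStrictlyPositive hσ.1)
    (BSEntropy.mul_ringInverse_of_isStrictlyPositive hTσ)
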